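/- Let $P$ be a poset and $F$ a field. View $P$ as a category with a unique morphism $y\to x$ if and only if $y\le x$, let $\operatorname{Rep}(P,F)$ be the category of contravariant $F$-linear representations of $P$, i.e. of functors from $P^{\mathrm{op}}$ to $F$-vector spaces, and for $x\in P$ let $h_x\in\operatorname{Rep}(P,F)$ be the representable object $y\mapsto F\operatorname{Hom}_P(y,x)$ (the vector space with basis $\operatorname{Hom}_P(y,x)$). Call an object $X$ of $\operatorname{Rep}(P,F)$ *finitely generated* if, whenever $X$ is the sum of a family of subobjects, it is the sum of finitely many members of that family; *finitely presented* if it is finitely generated and for every epimorphism $X'\to X$ with $X'$ finitely generated the kernel is finitely generated; and *coherent* if it is finitely presented and every finitely generated subobject of $X$ is finitely presented. Let $\operatorname{rep}(P,F)$ be the full subcategory of finitely presented objects of $\operatorname{Rep}(P,F)$. An *ideal* of a poset is a downward closed subset (possibly empty); the ideals form a complete lattice under inclusion. An element $c$ of a complete lattice is *compact* if $c\le\bigvee_{\alpha\in A}c_\alpha$ implies $c\le\bigvee_{\alpha\in B}c_\alpha$ for some finite $B\subseteq A$. Write $\downarrow\! x=\{y\in P\mid y\le x\}$. Then the following are equivalent.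 1. $P$ is coherent: for all $x,y,y'\in P$ with $y\le x\ge y'$ there are finitely many (possibly no) elements $z_\alpha\in P$ with $y\ge z_\alpha\le y'$ such that every $z\in P$ with $y\ge z\le y'$ satisfies $z\le z_\alpha$ for some $\alpha$. 2. For each $x\in P$, the compact elements of the lattice of ideals of $\downarrow\! x$ are closed under finite meets. 3. For each $x\in P$, the object $h_x$ of $\operatorname{Rep}(P,F)$ is coherent. 4. The category $\operatorname{rep}(P,F)$ is abelian. -/

import Mathlib

open CategoryTheory CategoryTheory.Limits

universe u v

namespace PosetRep

/-! ### Finiteness conditions on objects of an abelian category -/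

section Finiteness

variable {C : Type u} [Category.{v} C]

/-- An object `X` is finitely generated if, whenever `X` is the sum (i.e. the join in the
partially ordered class of subobjects of `X`) of a family of subobjects, it is already the sum of
finitely many members of this family. -/
def IsFinitelyGenerated (X : C) : Prop :=
  ∀ S : Set (Subobject X), IsLUB S ⊤ → ∃ T ⊆ S, T.Finite ∧ IsLUB T ⊤

variable [Abelian C]

/-- A finitely generated object `X` is finitely presented if the kernel of every epimorphism
`X' ⟶ X` from a finitely generated object `X'` is finitely generated. -/
def IsFinitelyPresented (X : C) : Prop :=
  IsFinitelyGenerated X ∧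
    ∀ (X' : C) (f : X' ⟶ X), Epi f → IsFinitelyGenerated X' → IsFinitelyGenerated (kernel f)

/-- A finitely presented object `X` is coherent if every finitely generated subobject of `X` is
finitely presented. -/
def IsCoherentObject (X : C) : Prop :=
  IsFinitelyPresented X ∧
    ∀ U : Subobject X, IsFinitelyGenerated (U : C) → IsFinitelyPresented (U : C)

end Finiteness

/-! ### Linear representations of a poset -/

/-- The category `Rep(P, F)` of contravariant `F`-linear representations of the poset `P`,
viewed as a category with a unique morphism `y ⟶ x` if and only if `y ≤ x`. -/
abbrev Rep (P : Type u) [PartialOrder P] (F : Type v) [Field F] :=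
  Pᵒᵖ ⥤ ModuleCat.{max u v} F

/-- The representation `h_x`, sending `y` to the `F`-vector space with basis the set of
morphisms `y ⟶ x` in `P`, with precomposition as transition maps. -/
noncomputable def representable {P : Type u} [PartialOrder P] (F : Type v) [Field F] (x : P) :
    Rep P F where
  obj y := ModuleCat.of F ((y.unop ⟶ x) →₀ F)
  map f := ModuleCat.ofHom (Finsupp.lmapDomain F F fun g => f.unop ≫ g)
  map_id y := by
    ext : 1
    simp only [unop_id, Category.id_comp]
    exact Finsupp.lmapDomain_id F F
  map_comp f g := by
    ext : 1
    simp only [unop_comp, Category.assoc]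
    exact Finsupp.lmapDomain_comp F F (fun h => f.unop ≫ h) fun h => g.unop ≫ h

/-- The category `rep(P, F)`: the full subcategory of `Rep(P, F)` of finitely presented objects. -/
abbrev FPRep (P : Type u) [PartialOrder P] (F : Type v) [Field F] :=
  ObjectProperty.FullSubcategory (fun X : Rep P F => IsFinitelyPresented X)

/-! ### Coherent posets -/

/-- A poset is coherent if for all `y ≤ x ≥ y'` there are finitely many common lower bounds of
`y` and `y'` such that every common lower bound lies below one of them. -/
def IsCoherentPoset (P : Type u) [PartialOrder P] : Prop :=
  ∀ x y y' : P, y ≤ x → y' ≤ x →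
    ∃ Z : Finset P, (∀ z ∈ Z, z ≤ y ∧ z ≤ y') ∧
      ∀ z : P, z ≤ y → z ≤ y' → ∃ w ∈ Z, z ≤ w

end PosetRep

/-! Since `P` is a poset, `h_x(z)` has dimension at most one, so every nonzero map `h_z ⟶ h_x` is a
scalar multiple of the inclusion given by `z ≤ x` (`exists_smul_representableMap`). A finitely
generated subobject of `h_x` is therefore determined by a finitely generated ideal of `↓x`, and
intersecting subobjects amounts to intersecting ideals.

1 ⇔ 2: the compact ideals are the finitely generated ones, and coherence says that two principal
ideals of `↓x` meet in such an ideal. 1 ⇒ 3: a finite sum of `h_y` inside `h_x` is built one summand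
at a time; `A + h_y` is `A ⊞ h_y` modulo `A ∩ h_y`, which coherence makes finitely generated. 3 ⇒ 4:
having only finitely presented finitely generated subobjects passes to finite biproducts and to
quotients with finitely generated kernel, hence to all finitely presented objects. These are then
closed under kernels and cokernels in `Rep P F`. 4 ⇒ 1: the pullback of `h_y ⟶ h_x ⟵ h_y'` in `FPRep
P F` receives a nonzero map from `h_z` exactly when `z ≤ y` and `z ≤ y'`. Its finitely many
generators yield the required lower bounds. -/

open Opposite

namespace PosetRep

/-! ### Representables: Yoneda, projectivity, maps between them, subrepresentations -/

section

variable {P : Type u} [PartialOrder P] {F : Type v} [Field F]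

/-- The morphism out of a representable object that corresponds to an element. -/
noncomputable def ofElement {X : Rep P F} {y : P} (a : X.obj (op y)) : representable F y ⟶ X where
  app z := ModuleCat.ofHom (Finsupp.linearCombination F fun g : z.unop ⟶ y => (X.map g.op).hom a)
  naturality z w f := by
    refine ModuleCat.hom_ext (Finsupp.lhom_ext fun g c => ?_)
    refine (congrArg (Finsupp.linearCombination F fun g : w.unop ⟶ y => (X.map g.op).hom a)
      (Finsupp.mapDomain_single (f := fun g : z.unop ⟶ y => f.unop ≫ g))).trans ?_
    refine (Finsupp.linearCombination_single F c _).trans ?_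
    refine Eq.trans ?_ (congrArg (X.map f).hom (Finsupp.linearCombination_single F c g)).symm
    rw [map_smul, op_comp, X.map_comp]
    rfl

/-- The canonical element of a representable object. -/
noncomputable def unit (F : Type v) [Field F] (y : P) : (representable F y).obj (op y) :=
  Finsupp.single (𝟙 y) (1 : F)

lemma ofElement_unit {X : Rep P F} {y : P} (a : X.obj (op y)) :
    ((ofElement a).app (op y)).hom (unit F y) = a := by
  refine (Finsupp.linearCombination_single F (1 : F) (𝟙 y)).trans ?_
  simp

lemma map_unit {y z : P} (g : z ⟶ y) :
    ((representable F y).map g.op).hom (unit F y) = Finsupp.single g (1 : F) := by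
  refine (Finsupp.mapDomain_single).trans ?_
  simp

lemma representable_hom_ext {X : Rep P F} {y : P} {f g : representable F y ⟶ X}
    (h : (f.app (op y)).hom (unit F y) = (g.app (op y)).hom (unit F y)) : f = g := by
  ext z : 2
  refine ModuleCat.hom_ext (Finsupp.lhom_ext' fun k => LinearMap.ext_ring ?_)
  change (f.app z).hom (Finsupp.single k (1 : F)) = (g.app z).hom (Finsupp.single k (1 : F))
  rw [← map_unit]
  have hf := congrArg (fun φ => φ.hom (unit F y)) (f.naturality k.op)
  have hg := congrArg (fun φ => φ.hom (unit F y)) (g.naturality k.op)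
  refine hf.trans (Eq.trans ?_ hg.symm)
  exact congrArg (X.map k.op).hom h

lemma epi_iff_app_surjective {X Y : Rep P F} (f : X ⟶ Y) :
    Epi f ↔ ∀ y, Function.Surjective (f.app y).hom := by
  rw [NatTrans.epi_iff_epi_app]
  exact forall_congr' fun y => ModuleCat.epi_iff_surjective _

lemma mono_iff_app_injective {X Y : Rep P F} (f : X ⟶ Y) :
    Mono f ↔ ∀ y, Function.Injective (f.app y).hom := by
  rw [NatTrans.mono_iff_mono_app]
  exact forall_congr' fun y => ModuleCat.mono_iff_injective _

instance projective_representable (y : P) : Projective (representable F y) where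
  factors {E X} f e he := by
    obtain ⟨a, ha⟩ := (epi_iff_app_surjective e).1 he (op y) ((f.app (op y)).hom (unit F y))
    refine ⟨ofElement a, representable_hom_ext ?_⟩
    refine Eq.trans ?_ ha
    exact congrArg (e.app (op y)).hom (ofElement_unit a)

/-- Yoneda: elements of `Y` are maps from representables. This form lets later arguments avoid
elements. -/
lemma epi_iff_representable_lift {X Y : Rep P F} (f : X ⟶ Y) :
    Epi f ↔ ∀ (y : P) (g : representable F y ⟶ Y), ∃ l, l ≫ f = g := by
  refine ⟨fun _ y g => ⟨Projective.factorThru g f, Projective.factorThru_comp g f⟩, fun h => ?_⟩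
  refine (epi_iff_app_surjective f).2 fun y b => ?_
  obtain ⟨l, hl⟩ := h y.unop (ofElement b)
  refine ⟨(l.app y).hom (unit F y.unop), ?_⟩
  refine Eq.trans ?_ (ofElement_unit b)
  rw [← hl]
  rfl

/-- The morphism of representable objects induced by an inequality. -/
noncomputable def representableMap (F : Type v) [Field F] {y x : P} (h : y ≤ x) :
    representable F y ⟶ representable F x :=
  ofElement (X := representable F x) (Finsupp.single (homOfLE h) (1 : F))

lemma representableMap_app {y x : P} (h : y ≤ x) {z : P} (g : z ⟶ y) (a : F) :
    ((representableMap F h).app (op z)).hom (Finsupp.single g a) =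
      Finsupp.single (g ≫ homOfLE h) a := by
  refine (Finsupp.linearCombination_single F a g).trans ?_
  refine (congrArg (a • ·) (Finsupp.mapDomain_single)).trans ?_
  refine (Finsupp.smul_single _ _ _).trans ?_
  simp

lemma representableMap_comp {z y x : P} (h : z ≤ y) (h' : y ≤ x) :
    representableMap F h ≫ representableMap F h' = representableMap F (h.trans h') := by
  refine representable_hom_ext ?_
  change ((representableMap F h').app (op z)).hom (((representableMap F h).app (op z)).hom
    (Finsupp.single (𝟙 z) (1 : F))) = ((representableMap F (h.trans h')).app (op z)).hom
    (Finsupp.single (𝟙 z) (1 : F))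
  rw [representableMap_app, representableMap_app, representableMap_app]
  rfl

instance mono_representableMap {y x : P} (h : y ≤ x) : Mono (representableMap F h) := by
  refine (mono_iff_app_injective _).2 fun z => ?_
  have : ((representableMap F h).app z).hom =
      Finsupp.lmapDomain F F fun g : z.unop ⟶ y => g ≫ homOfLE h := by
    refine Finsupp.lhom_ext fun g a => ?_
    exact (representableMap_app h g a).trans
      (Finsupp.mapDomain_single (f := fun g : z.unop ⟶ y => g ≫ homOfLE h)).symm
  rw [this]
  exact Finsupp.mapDomain_injective fun _ _ _ => Subsingleton.elim _ _

lemma representableMap_ne_zero {y x : P} (h : y ≤ x) : representableMap F h ≠ 0 := by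
  intro h0
  have h1 := congrArg (fun φ => (φ.app (op y)).hom (unit F y)) h0
  have h2 := (ofElement_unit (X := representable F x)
    (Finsupp.single (homOfLE h) (1 : F))).symm.trans h1
  exact one_ne_zero (Finsupp.single_eq_zero.1 h2)

lemma exists_smul_representableMap {z x : P} (f : representable F z ⟶ representable F x)
    (hf : f ≠ 0) : ∃ (h : z ≤ x) (c : F), c ≠ 0 ∧ f = c • representableMap F h := by
  by_cases h : z ≤ x
  · let b : (z ⟶ x) →₀ F := (f.app (op z)).hom (unit F z)
    have hb : b = Finsupp.single (homOfLE h) (b (homOfLE h)) := by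
      ext k
      rw [Subsingleton.elim k (homOfLE h), Finsupp.single_eq_same]
    have key : f = b (homOfLE h) • representableMap F h := by
      refine representable_hom_ext ?_
      change b = b (homOfLE h) •
        ((representableMap F h).app (op z)).hom (Finsupp.single (𝟙 z) (1 : F))
      rw [representableMap_app]
      refine hb.trans (Eq.trans ?_ (Finsupp.smul_single _ _ _).symm)
      simp
    refine ⟨h, _, ?_, key⟩
    intro h0
    rw [h0, zero_smul] at key
    exact hf key
  · refine (hf (representable_hom_ext ?_)).elim
    have : IsEmpty (z ⟶ x) := ⟨fun k => h (leOfHom k)⟩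
    exact Subsingleton.elim (α := (z ⟶ x) →₀ F) _ _

/-- The subrepresentation given by a compatible family of subspaces. -/
noncomputable def sub (X : Rep P F) (N : ∀ y, Submodule F (X.obj y))
    (hN : ∀ {y z} (f : y ⟶ z), ∀ a ∈ N y, (X.map f).hom a ∈ N z) : Rep P F where
  obj y := ModuleCat.of F (N y)
  map f := ModuleCat.ofHom ((X.map f).hom.restrict (hN f))
  map_id y := by
    refine ModuleCat.hom_ext (LinearMap.ext fun a => Subtype.ext ?_)
    exact congrArg (fun φ => φ.hom a.1) (X.map_id y)
  map_comp f g := by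
    refine ModuleCat.hom_ext (LinearMap.ext fun a => Subtype.ext ?_)
    exact congrArg (fun φ => φ.hom a.1) (X.map_comp f g)

/-- The inclusion of a subrepresentation. -/
noncomputable def subι (X : Rep P F) (N : ∀ y, Submodule F (X.obj y))
    (hN : ∀ {y z} (f : y ⟶ z), ∀ a ∈ N y, (X.map f).hom a ∈ N z) : sub X N hN ⟶ X where
  app y := ModuleCat.ofHom (N y).subtype

instance (X : Rep P F) (N : ∀ y, Submodule F (X.obj y))
    (hN : ∀ {y z} (f : y ⟶ z), ∀ a ∈ N y, (X.map f).hom a ∈ N z) : Mono (subι X N hN) :=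
  (mono_iff_app_injective _).2 fun y => (N y).injective_subtype

lemma subι_factor {X Y : Rep P F} (N : ∀ y, Submodule F (X.obj y))
    (hN : ∀ {y z} (f : y ⟶ z), ∀ a ∈ N y, (X.map f).hom a ∈ N z) (g : Y ⟶ X)
    (hg : ∀ y a, (g.app y).hom a ∈ N y) : ∃ l, l ≫ subι X N hN = g := by
  refine ⟨{ app := fun y => ModuleCat.ofHom ((g.app y).hom.codRestrict (N y) (hg y))
            naturality := fun y z f => ?_ }, ?_⟩
  · refine ModuleCat.hom_ext (LinearMap.ext fun a => Subtype.ext ?_)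
    exact congrArg (fun φ => φ.hom a) (g.naturality f)
  · ext y : 2
    rfl

/-! ### Finite generation by maps from representables -/

/-- A set of morphisms from representable objects to `X` generates `X` if every subobject through
which these morphisms factor is the whole of `X`. -/
def Generates {X : Rep P F} (s : Set (Σ y, representable F y ⟶ X)) : Prop :=
  ∀ (A : Rep P F) (i : A ⟶ X), Mono i → (∀ p ∈ s, ∃ l, l ≫ i = p.2) → Epi i

lemma Generates.epi {X : Rep P F} {s : Set (Σ y, representable F y ⟶ X)} (hs : Generates s)
    {A : Rep P F} (f : A ⟶ X) (hf : ∀ p ∈ s, ∃ l, l ≫ f = p.2) : Epi f := by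
  have : Epi (image.ι f) := hs _ (image.ι f) inferInstance fun p hp => by
    obtain ⟨l, hl⟩ := hf p hp
    exact ⟨l ≫ factorThruImage f, by rw [Category.assoc, image.fac, hl]⟩
  rw [← image.fac f]
  exact epi_comp _ _

/-- Forwards, the images of all maps from representables sum to `X`. Backwards, sums of subobjects
are computed pointwise, so each of the finitely many generators already lies in a finite partial
sum. -/
lemma isFinitelyGenerated_iff (X : Rep P F) :
    IsFinitelyGenerated X ↔
      ∃ s : Set (Σ y, representable F y ⟶ X), s.Finite ∧ Generates s := by
  constructor
  · intro h
    let Φ : (Σ y, representable F y ⟶ X) → Subobject X := fun p => imageSubobject p.2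
    obtain ⟨T, hTS, hT, hlub⟩ := h (Φ '' Set.univ) ⟨fun _ _ => le_top, fun V hV => by
      have : Epi V.arrow := (epi_iff_representable_lift _).2 fun y g =>
        ⟨factorThruImageSubobject g ≫ Subobject.ofLE _ _ (hV ⟨⟨y, g⟩, trivial, rfl⟩), by simp⟩
      have : IsIso V.arrow := isIso_of_mono_of_epi _
      exact (Subobject.eq_top_of_isIso_arrow V).ge⟩
    obtain ⟨s, -, hs, rfl⟩ := Set.exists_subset_image_finite_and.1 ⟨T, hTS, hT, rfl⟩
    refine ⟨s, hs, fun A i _ hi => ?_⟩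
    rw [Subobject.epi_iff_mk_eq_top]
    refine top_le_iff.1 (hlub.2 ?_)
    rintro _ ⟨p, hp, rfl⟩
    obtain ⟨l, hl⟩ := hi p hp
    exact imageSubobject_le_mk i _ l hl
  · rintro ⟨s, hs, hgen⟩ S hS
    let N : ∀ y, Submodule F (X.obj y) := fun y =>
      ⨆ V : S, LinearMap.range ((V : Subobject X).arrow.app y).hom
    have hN : ∀ {y z} (f : y ⟶ z), ∀ a ∈ N y, (X.map f).hom a ∈ N z := by
      intro y z f a ha
      have : N y ≤ (N z).comap (X.map f).hom := by
        refine iSup_le fun V => ?_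
        rintro _ ⟨b, rfl⟩
        refine (le_iSup (fun V : S => LinearMap.range ((V : Subobject X).arrow.app z).hom) V) ?_
        refine ⟨(((V : Subobject X) : Rep P F).map f).hom b, ?_⟩
        exact congrArg (fun φ => φ.hom b) ((V : Subobject X).arrow.naturality f)
      exact this ha
    have htop : Subobject.mk (subι X N hN) = ⊤ := by
      refine top_le_iff.1 (hS.2 fun V hV => ?_)
      obtain ⟨l, hl⟩ := subι_factor N hN V.arrow fun y a =>
        (le_iSup (fun V : S => LinearMap.range ((V : Subobject X).arrow.app y).hom) ⟨V, hV⟩)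
          ⟨a, rfl⟩
      exact Subobject.le_mk_of_comm l hl
    have hepi : Epi (subι X N hN) := (Subobject.epi_iff_mk_eq_top _).2 htop
    have hfin : ∀ p : Σ y, representable F y ⟶ X, ∃ t : Finset S,
        (p.2.app (op p.1)).hom (unit F p.1) ∈
          ⨆ V ∈ t, LinearMap.range ((V : Subobject X).arrow.app (op p.1)).hom := by
      intro p
      obtain ⟨b, hb⟩ := (epi_iff_app_surjective _).1 hepi (op p.1)
        ((p.2.app (op p.1)).hom (unit F p.1))
      rw [← hb]
      exact (Submodule.mem_iSup_iff_exists_finset).1 b.2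
    choose t ht using hfin
    refine ⟨⋃ p ∈ s, Subtype.val '' (t p : Set S), ?_, ?_, fun _ _ => le_top, fun W hW => ?_⟩
    · refine Set.iUnion₂_subset fun p _ => ?_
      rintro _ ⟨V, -, rfl⟩
      exact V.2
    · exact hs.biUnion fun p _ => (t p).finite_toSet.image _
    · have : Epi W.arrow := hgen _ W.arrow inferInstance fun p hp => by
        have hle : (⨆ V ∈ t p, LinearMap.range ((V : Subobject X).arrow.app (op p.1)).hom) ≤
            LinearMap.range (W.arrow.app (op p.1)).hom := by
          refine iSup₂_le fun V hV => ?_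
          have hVW : (V : Subobject X) ≤ W := hW (Set.mem_biUnion hp ⟨V, hV, rfl⟩)
          rintro _ ⟨b, rfl⟩
          refine ⟨((Subobject.ofLE _ _ hVW).app (op p.1)).hom b, ?_⟩
          exact congrArg (fun φ => (φ.app (op p.1)).hom b) (Subobject.ofLE_arrow hVW)
        obtain ⟨a, ha⟩ := hle (ht p)
        refine ⟨ofElement a, representable_hom_ext ?_⟩
        refine Eq.trans ?_ ha
        exact congrArg (W.arrow.app (op p.1)).hom (ofElement_unit a)
      have : IsIso W.arrow := isIso_of_mono_of_epi _
      exact (Subobject.eq_top_of_isIso_arrow W).ge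

/-- The property of being finitely generated. -/
abbrev finitelyGenerated (C : Type*) [Category C] : ObjectProperty C :=
  fun X => IsFinitelyGenerated X

instance : (finitelyGenerated (Rep P F)).IsClosedUnderQuotients where
  prop_of_epi {X Y} f _ hX := by
    obtain ⟨s, hs, hgen⟩ := (isFinitelyGenerated_iff X).1 hX
    refine (isFinitelyGenerated_iff Y).2
      ⟨(fun p => ⟨p.1, p.2 ≫ f⟩) '' s, hs.image _, fun A i _ hi => ?_⟩
    have : Epi (pullback.fst f i) := hgen.epi _ fun p hp => by
      obtain ⟨l, hl⟩ := hi _ ⟨p, hp, rfl⟩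
      exact ⟨pullback.lift p.2 l hl.symm, pullback.lift_fst _ _ _⟩
    have : Epi (pullback.snd f i ≫ i) := by
      rw [← pullback.condition]
      exact epi_comp _ _
    exact epi_of_epi (pullback.snd f i) i

/-- Generators of the kernel together with lifts of generators of the quotient generate the middle
term; the lifts exist because representables are projective. -/
instance : (finitelyGenerated (Rep P F)).IsClosedUnderExtensions where
  prop_X₂_of_shortExact {S} hS h₁ h₃ := by
    have := hS.mono_f
    have := hS.epi_g
    obtain ⟨s₁, hs₁, hgen₁⟩ := (isFinitelyGenerated_iff _).1 h₁
    obtain ⟨s₃, hs₃, hgen₃⟩ := (isFinitelyGenerated_iff _).1 h₃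
    refine (isFinitelyGenerated_iff _).2
      ⟨(fun p => ⟨p.1, p.2 ≫ S.f⟩) '' s₁ ∪ (fun p => ⟨p.1, Projective.factorThru p.2 S.g⟩) '' s₃,
        (hs₁.image _).union (hs₃.image _), fun A i _ hi => ?_⟩
    have e₁ : Epi (pullback.fst S.f i) := hgen₁.epi _ fun p hp => by
      obtain ⟨l, hl⟩ := hi _ (Or.inl ⟨p, hp, rfl⟩)
      exact ⟨pullback.lift p.2 l hl.symm, pullback.lift_fst _ _ _⟩
    have e₃ : Epi (i ≫ S.g) := hgen₃.epi _ fun p hp => by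
      obtain ⟨l, hl⟩ := hi _ (Or.inr ⟨p, hp, rfl⟩)
      exact ⟨l, by rw [← Category.assoc, hl, Projective.factorThru_comp]⟩
    -- Modulo `S.X₁`, `b` comes from a map `a` into `A`; the error `b - a ≫ i` lands in `S.X₁`,
    -- which is contained in `A` by `e₁`.
    refine (epi_iff_representable_lift i).2 fun y b => ?_
    let a := Projective.factorThru (b ≫ S.g) (i ≫ S.g)
    have ha : a ≫ i ≫ S.g = b ≫ S.g := Projective.factorThru_comp _ _
    let c := hS.exact.lift (b - a ≫ i) (by simp [ha])
    have hc : c ≫ S.f = b - a ≫ i := hS.exact.lift_f _ _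
    let d := Projective.factorThru c (pullback.fst S.f i)
    have hd : d ≫ pullback.fst S.f i = c := Projective.factorThru_comp _ _
    refine ⟨a + d ≫ pullback.snd S.f i, ?_⟩
    rw [Preadditive.add_comp, Category.assoc, ← pullback.condition, ← Category.assoc, hd, hc]
    abel

lemma isFinitelyGenerated_representable (y : P) : IsFinitelyGenerated (representable F y) := by
  refine (isFinitelyGenerated_iff _).2 ⟨{⟨y, 𝟙 _⟩}, Set.finite_singleton _, fun A i _ hi => ?_⟩
  obtain ⟨l, hl⟩ := hi _ rfl
  exact (SplitEpi.mk l hl).epi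

end

/-! ### Finite presentation in an abelian category where finite generation passes to quotients and
extensions -/

section Abelian

variable {C : Type u} [Category.{v} C]

lemma isFinitelyGenerated_of_isZero [HasZeroMorphisms C] [HasZeroObject C] {X : C}
    (hX : IsZero X) : IsFinitelyGenerated X := by
  have := Subobject.subsingleton_of_isZero hX
  exact fun S _ => ⟨∅, Set.empty_subset _, Set.finite_empty,
    fun _ _ => le_top, fun _ _ => (Subsingleton.elim _ _).le⟩

lemma IsFinitelyGenerated.of_epi [(finitelyGenerated C).IsClosedUnderQuotients] {X Y : C}
    (f : X ⟶ Y) [Epi f] (h : IsFinitelyGenerated X) :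
    IsFinitelyGenerated Y :=
  (finitelyGenerated C).prop_of_epi f h

lemma IsFinitelyGenerated.of_iso [(finitelyGenerated C).IsClosedUnderQuotients] {X Y : C}
    (e : X ≅ Y) (h : IsFinitelyGenerated X) :
    IsFinitelyGenerated Y :=
  h.of_epi e.hom

variable [Abelian C]

lemma shortExact_kernel {X Y : C} (f : X ⟶ Y) [Epi f] :
    (ShortComplex.mk (kernel.ι f) f (kernel.condition f)).ShortExact where
  exact := ShortComplex.exact_of_f_is_kernel _ (kernelIsKernel f)
  mono_f := inferInstanceAs (Mono (kernel.ι f))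
  epi_g := inferInstanceAs (Epi f)

lemma IsFinitelyGenerated.of_kernel [(finitelyGenerated C).IsClosedUnderExtensions] {X Y : C}
    (f : X ⟶ Y) [Epi f]
    (hK : IsFinitelyGenerated (kernel f)) (hY : IsFinitelyGenerated Y) : IsFinitelyGenerated X :=
  (finitelyGenerated C).prop_X₂_of_shortExact (shortExact_kernel f) hK hY

/-- The property of being finitely presented. -/
abbrev finitelyPresented (C : Type u) [Category.{v} C] [Abelian C] : ObjectProperty C :=
  fun X => IsFinitelyPresented X

/-- All finitely generated subobjects of `X` are finitely presented. -/
def SubobjectsCoherent (X : C) : Prop :=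
  ∀ ⦃A : C⦄ (a : A ⟶ X) [Mono a], IsFinitelyGenerated A → IsFinitelyPresented A

variable [(finitelyGenerated C).IsClosedUnderQuotients]

lemma IsFinitelyGenerated.image {X Y : C} (h : IsFinitelyGenerated X) (f : X ⟶ Y) :
    IsFinitelyGenerated (image f) :=
  h.of_epi (factorThruImage f)

lemma isFinitelyGenerated_kernel_iff {X₁ X₂ X₃ X₄ : C} {t : X₁ ⟶ X₂} {l : X₁ ⟶ X₃} {r : X₂ ⟶ X₄}
    {b : X₃ ⟶ X₄} (sq : IsPullback t l r b) :
    IsFinitelyGenerated (kernel t) ↔ IsFinitelyGenerated (kernel b) := by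
  have := isIso_kernel_map_of_isPullback sq
  let e := asIso (kernel.map _ _ _ _ sq.w)
  exact ⟨fun h => h.of_iso e, fun h => h.of_iso e.symm⟩

lemma isFinitelyGenerated_kernel_of_shortExact {S : ShortComplex C} (hS : S.ShortExact)
    (h : IsFinitelyGenerated S.X₁) : IsFinitelyGenerated (kernel S.g) :=
  h.of_iso (hS.fIsKernel.conePointUniqueUpToIso (limit.isLimit _))

lemma IsFinitelyPresented.of_iso {X Y : C} (e : X ≅ Y) (h : IsFinitelyPresented X) :
    IsFinitelyPresented Y := by
  refine ⟨h.1.of_iso e, fun X' f _ hX' => ?_⟩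
  have := h.2 X' (f ≫ e.inv) (epi_comp _ _) hX'
  exact this.of_iso (kernelCompMono f e.inv)

instance : (finitelyPresented C).IsClosedUnderIsomorphisms where
  of_iso e h := IsFinitelyPresented.of_iso e h

/-- The epimorphism splits, so its kernel is a retract of `X'`. -/
lemma isFinitelyPresented_of_projective {X : C} [Projective X] (h : IsFinitelyGenerated X) :
    IsFinitelyPresented X := by
  refine ⟨h, fun X' f _ hX' => ?_⟩
  let s := Projective.factorThru (𝟙 X) f
  have hs : s ≫ f = 𝟙 X := Projective.factorThru_comp _ _
  let r : X' ⟶ kernel f := kernel.lift f (𝟙 X' - f ≫ s) (by simp [hs])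
  have hr : kernel.ι f ≫ r = 𝟙 _ := by
    rw [← cancel_mono (kernel.ι f)]
    simp [r]
  have : Epi r := (SplitEpi.mk _ hr).epi
  exact hX'.of_epi r

lemma isFinitelyPresented_of_isZero {X : C} (hX : IsZero X) : IsFinitelyPresented X :=
  have := hX.projective
  isFinitelyPresented_of_projective (isFinitelyGenerated_of_isZero hX)

lemma IsCoherentObject.subobjectsCoherent {X : C} (h : IsCoherentObject X) :
    SubobjectsCoherent X := fun _ a _ hA =>
  (h.2 (Subobject.mk a) (hA.of_iso (Subobject.underlyingIso a).symm)).of_iso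
    (Subobject.underlyingIso a)

variable [(finitelyGenerated C).IsClosedUnderExtensions]

instance : (finitelyPresented C).IsClosedUnderExtensions where
  prop_X₂_of_shortExact {S} hS h₁ h₃ := by
    have := hS.mono_f
    have := hS.epi_g
    refine ⟨(finitelyGenerated C).prop_X₂_of_shortExact hS h₁.1 h₃.1, fun X' p _ hX' => ?_⟩
    have hK := h₃.2 X' (p ≫ S.g) (epi_comp _ _) hX'
    let t : kernel (p ≫ S.g) ⟶ S.X₁ := hS.exact.lift (kernel.ι (p ≫ S.g) ≫ p) (by simp)
    have ht : t ≫ S.f = kernel.ι (p ≫ S.g) ≫ p := hS.exact.lift_f _ _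
    -- The preimage of `S.X₁` under `p` maps onto `S.X₁` with the same kernel as `p`.
    have sq : IsPullback t (kernel.ι (p ≫ S.g)) S.f p :=
      ⟨⟨ht⟩, ⟨PullbackCone.IsLimit.mk _ (fun s => kernel.lift _ s.snd (by
          rw [← Category.assoc, ← s.condition, Category.assoc, S.zero, comp_zero]))
        (fun s => by
          rw [← cancel_mono S.f, Category.assoc, ht, kernel.lift_ι_assoc, s.condition])
        (fun s => kernel.lift_ι _ _ _)
        (fun s m _ hm => by
          rw [← cancel_mono (kernel.ι (p ≫ S.g)), hm, kernel.lift_ι])⟩⟩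
    have : Epi t := (MorphismProperty.epimorphisms C).of_isPullback sq.flip ‹Epi p›
    exact (isFinitelyGenerated_kernel_iff sq).1 (h₁.2 _ t this hK)

/-- In the pullback of `q` and `S.g`, the projection to `X'` has kernel `S.X₁`, so the pullback is
finitely generated; the projection to `S.X₂` has the kernel of `q`. -/
lemma IsFinitelyPresented.of_shortExact {S : ShortComplex C} (hS : S.ShortExact)
    (h₁ : IsFinitelyGenerated S.X₁) (h₂ : IsFinitelyPresented S.X₂) :
    IsFinitelyPresented S.X₃ := by
  have := hS.epi_g
  refine ⟨h₂.1.of_epi S.g, fun X' q _ hX' => ?_⟩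
  have sq := IsPullback.of_hasPullback q S.g
  have hZ : IsFinitelyGenerated (pullback q S.g) :=
    .of_kernel (pullback.fst q S.g)
      ((isFinitelyGenerated_kernel_iff sq).2 (isFinitelyGenerated_kernel_of_shortExact hS h₁)) hX'
  exact (isFinitelyGenerated_kernel_iff sq.flip).1
    (h₂.2 _ (pullback.snd q S.g) inferInstance hZ)

/-- If two subobjects of `X` are finitely presented and have a finitely generated intersection,
then their sum is finitely presented. -/
lemma isFinitelyPresented_image_desc {A B X : C} (a : A ⟶ X) (b : B ⟶ X)
    (hA : IsFinitelyPresented A) (hB : IsFinitelyPresented B)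
    (h : IsFinitelyGenerated (pullback a b)) : IsFinitelyPresented (image (biprod.desc a b)) := by
  have hK : IsFinitelyGenerated (kernel (factorThruImage (biprod.desc a b))) := by
    let k : pullback a b ⟶ kernel (biprod.desc a b) :=
      kernel.lift _ (biprod.lift (pullback.fst a b) (-pullback.snd a b))
        (by simp [pullback.condition])
    have hw : (kernel.ι (biprod.desc a b) ≫ biprod.fst) ≫ a =
        (-(kernel.ι (biprod.desc a b) ≫ biprod.snd)) ≫ b := by
      have h0 : kernel.ι (biprod.desc a b) ≫ (biprod.fst ≫ a + biprod.snd ≫ b) = 0 := by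
        rw [← biprod.desc_eq, kernel.condition]
      rw [Preadditive.comp_add] at h0
      rw [Preadditive.neg_comp, Category.assoc, Category.assoc]
      exact eq_neg_of_add_eq_zero_left h0
    have hk : pullback.lift _ _ hw ≫ k = 𝟙 _ := by
      rw [← cancel_mono (kernel.ι _), Category.assoc, kernel.lift_ι]
      refine biprod.hom_ext _ _ ?_ ?_
      · rw [Category.assoc, biprod.lift_fst, pullback.lift_fst, Category.id_comp]
      · rw [Category.assoc, biprod.lift_snd, Preadditive.comp_neg, pullback.lift_snd, neg_neg,
          Category.id_comp]
    have : Epi k := (SplitEpi.mk _ hk).epi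
    refine (h.of_epi k).of_iso ?_
    exact kernelIsoOfEq (image.fac _).symm ≪≫ kernelCompMono _ _
  exact .of_shortExact (shortExact_kernel (factorThruImage (biprod.desc a b))) hK
    ((finitelyPresented C).prop_biprod hA hB)

/-- `A` is an extension of its image in `Y` by a subobject of `X`; the latter is finitely generated
because the image is finitely presented. -/
lemma SubobjectsCoherent.biprod {X Y : C} (hX : SubobjectsCoherent X) (hY : SubobjectsCoherent Y) :
    SubobjectsCoherent (X ⊞ Y) := by
  intro A a _ hA
  let q := factorThruImage (a ≫ biprod.snd)
  have hI : IsFinitelyPresented (image (a ≫ biprod.snd)) := hY (image.ι _) (hA.image _)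
  let k : kernel q ⟶ X := kernel.ι q ≫ a ≫ biprod.fst
  have hq : kernel.ι q ≫ a ≫ biprod.snd = 0 := by
    have := kernel.condition_assoc q (image.ι (a ≫ biprod.snd))
    rwa [image.fac, zero_comp] at this
  have : Mono k := Preadditive.mono_of_cancel_zero _ fun g hg => by
    rw [← cancel_mono (kernel.ι q), ← cancel_mono a, zero_comp, zero_comp]
    ext
    · simpa [k] using hg
    · simp [hq]
  have hK : IsFinitelyPresented (kernel q) := hX k (hI.2 _ q inferInstance hA)
  exact (finitelyPresented C).prop_X₂_of_shortExact (shortExact_kernel q) hK hI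

/-- The preimage of `A` in `X` is an extension of `A` by `kernel f`, hence finitely generated and so
finitely presented; `A` is its quotient by that kernel. -/
lemma SubobjectsCoherent.of_epi {X Y : C} (hX : SubobjectsCoherent X) (f : X ⟶ Y) [Epi f]
    (hf : IsFinitelyGenerated (kernel f)) : SubobjectsCoherent Y := by
  intro A a _ hA
  have hK : IsFinitelyGenerated (kernel (pullback.snd f a)) :=
    (isFinitelyGenerated_kernel_iff (IsPullback.of_hasPullback f a).flip).2 hf
  have hV : IsFinitelyPresented (pullback f a) :=
    hX (pullback.fst f a) (.of_kernel (pullback.snd f a) hK hA)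
  exact .of_shortExact (shortExact_kernel (pullback.snd f a)) hK hV

open scoped ZeroObject in
/-- If finitely generated subobjects of finitely presented objects are finitely presented, then
the finitely presented objects form an abelian category. -/
theorem nonempty_abelian_finitelyPresented
    (h : ∀ X : C, IsFinitelyPresented X → SubobjectsCoherent X) :
    Nonempty (Abelian (finitelyPresented C).FullSubcategory) := by
  have : (finitelyPresented C).ContainsZero :=
    ⟨0, isZero_zero C, isFinitelyPresented_of_isZero (isZero_zero C)⟩
  have : (finitelyPresented C).IsClosedUnderBinaryProducts := ⟨by
    rintro X ⟨p⟩
    let e : X ≅ p.diag.obj ⟨.left⟩ ⨯ p.diag.obj ⟨.right⟩ :=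
      p.isLimit.conePointsIsoOfNatIso (limit.isLimit _) (diagramIsoPair p.diag)
    exact IsFinitelyPresented.of_iso (biprod.isoProd _ _ ≪≫ e.symm)
      ((finitelyPresented C).prop_biprod (p.prop_diag_obj _) (p.prop_diag_obj _))⟩
  have : (finitelyPresented C).IsClosedUnderFiniteProducts :=
    ObjectProperty.IsClosedUnderFiniteProducts.mk'
  have hI : ∀ {X Y : C} (f : X ⟶ Y), IsFinitelyPresented X → IsFinitelyPresented Y →
      IsFinitelyPresented (image f) := fun f hX hY => h _ hY (image.ι f) (hX.1.image f)
  have : (finitelyPresented C).IsClosedUnderKernels := ⟨by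
    rintro _ ⟨f, k, hk, hX, hY⟩
    have hK := (hI f hX hY).2 _ (factorThruImage f) inferInstance hX.1
    have e : kernel (factorThruImage f) ≅ kernel f :=
      (kernelCompMono _ _).symm ≪≫ kernelIsoOfEq (image.fac f)
    exact (h _ hX (kernel.ι f) (hK.of_iso e)).of_iso
      ((limit.isLimit _).conePointUniqueUpToIso hk)⟩
  have : (finitelyPresented C).IsClosedUnderCokernels := ⟨by
    rintro _ ⟨f, k, hk, hX, hY⟩
    have : Epi (cokernel.π f) := inferInstance
    have hK : IsFinitelyGenerated (kernel (cokernel.π f)) :=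
      (hX.1.image f).of_iso (Abelian.imageIsoImage f).symm
    exact (IsFinitelyPresented.of_shortExact (shortExact_kernel (cokernel.π f)) hK hY).of_iso
      ((colimit.isColimit _).coconePointUniqueUpToIso hk)⟩
  exact ⟨inferInstance⟩

end Abelian

section

variable {P : Type u} [PartialOrder P] {F : Type v} [Field F]

lemma isFinitelyPresented_representable (y : P) : IsFinitelyPresented (representable F y) :=
  isFinitelyPresented_of_projective (isFinitelyGenerated_representable y)

/-! ### Coherent representables give an abelian category -/

lemma exists_coherent_cover (h : ∀ x : P, IsCoherentObject (representable F x)) {X : Rep P F}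
    {s : Set (Σ y, representable F y ⟶ X)} (hs : s.Finite) :
    ∃ (Y : Rep P F) (f : Y ⟶ X), SubobjectsCoherent Y ∧ IsFinitelyGenerated Y ∧
      ∀ p ∈ s, ∃ l, l ≫ f = p.2 := by
  induction s, hs using Set.Finite.induction_on with
  | empty =>
    obtain ⟨Z, hZ⟩ := HasZeroObject.zero (C := Rep P F)
    exact ⟨Z, 0, fun _ a _ _ => isFinitelyPresented_of_isZero (.of_mono a hZ),
      isFinitelyGenerated_of_isZero hZ, by simp⟩
  | @insert p s _ _ ih =>
    obtain ⟨Y, f, hY, hfg, hf⟩ := ih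
    refine ⟨Y ⊞ representable F p.1, biprod.desc f p.2, hY.biprod (h p.1).subobjectsCoherent,
      (finitelyGenerated _).prop_biprod hfg (isFinitelyGenerated_representable p.1), ?_⟩
    rintro q (rfl | hq)
    · exact ⟨biprod.inr, biprod.inr_desc _ _⟩
    · obtain ⟨l, hl⟩ := hf q hq
      exact ⟨l ≫ biprod.inl, by rw [Category.assoc, biprod.inl_desc, hl]⟩

lemma subobjectsCoherent_of_isFinitelyPresented
    (h : ∀ x : P, IsCoherentObject (representable F x)) (X : Rep P F)
    (hX : IsFinitelyPresented X) : SubobjectsCoherent X := by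
  obtain ⟨s, hs, hgen⟩ := (isFinitelyGenerated_iff X).1 hX.1
  obtain ⟨Y, f, hY, hfg, hf⟩ := exists_coherent_cover h hs
  have : Epi f := hgen.epi f hf
  exact hY.of_epi f (hX.2 Y f this hfg)

/-! ### Representables over a coherent poset -/

/-- `A` is the sum of the `h_y`, `y ∈ Z`, inside `h_x`; the last clause says that its support is the
ideal generated by `Z`, which is what the induction needs to control intersections. -/
lemma exists_isFinitelyPresented_subobject (hP : IsCoherentPoset P) (x : P) (Z : Finset P)
    (hZ : ∀ y ∈ Z, y ≤ x) :
    ∃ (A : Rep P F) (a : A ⟶ representable F x), Mono a ∧ IsFinitelyPresented A ∧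
      ∀ (z : P) (h : z ≤ x), (∃ l, l ≫ a = representableMap F h) ↔ ∃ y ∈ Z, z ≤ y := by
  classical
  induction Z using Finset.induction_on with
  | empty =>
    obtain ⟨A, hA⟩ := HasZeroObject.zero (C := Rep P F)
    refine ⟨A, 0, hA.mono _, isFinitelyPresented_of_isZero hA, fun z h => ?_⟩
    simpa using (representableMap_ne_zero h).symm
  | insert y Z _ ih =>
    obtain ⟨A, a, _, hA, haZ⟩ := ih fun y' hy' => hZ y' (Finset.mem_insert_of_mem hy')
    have hyx : y ≤ x := hZ y (Finset.mem_insert_self _ _)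
    let b : representable F y ⟶ representable F x := representableMap F hyx
    let k : pullback a b ⟶ representable F x := pullback.fst a b ≫ a
    have hk : k = pullback.snd a b ≫ b := pullback.condition
    have hkm : Mono k := mono_comp _ _
    -- `W` generates the intersection of `↓y` with the ideal of `Z`: coherence is applied to each
    -- pair `y, y'`, and the results are united.
    have hW : ∃ W : Finset P, (∀ w ∈ W, w ≤ y ∧ ∃ y' ∈ Z, w ≤ y') ∧
        ∀ z, z ≤ y → (∃ y' ∈ Z, z ≤ y') → ∃ w ∈ W, z ≤ w := by
      have : ∀ y' : Z, ∃ W : Finset P, (∀ w ∈ W, w ≤ y ∧ w ≤ y') ∧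
          ∀ z, z ≤ y → z ≤ y' → ∃ w ∈ W, z ≤ w := fun y' =>
        hP x y y' hyx (hZ _ (Finset.mem_insert_of_mem y'.2))
      choose W hW₁ hW₂ using this
      refine ⟨Finset.univ.biUnion W, fun w hw => ?_, ?_⟩
      · obtain ⟨y', -, hw⟩ := Finset.mem_biUnion.1 hw
        exact ⟨(hW₁ y' w hw).1, y', y'.2, (hW₁ y' w hw).2⟩
      · rintro z hz ⟨y', hy', hz'⟩
        obtain ⟨w, hw, hzw⟩ := hW₂ ⟨y', hy'⟩ z hz hz'
        exact ⟨w, Finset.mem_biUnion.2 ⟨_, Finset.mem_univ _, hw⟩, hzw⟩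
    obtain ⟨W, hW₁, hW₂⟩ := hW
    have hl : ∀ w : W, ∃ l : representable F w.1 ⟶ pullback a b,
        l ≫ k = representableMap F ((hW₁ w w.2).1.trans hyx) := by
      intro w
      obtain ⟨l, hl⟩ := (haZ w ((hW₁ w w.2).1.trans hyx)).2 (hW₁ w w.2).2
      refine ⟨pullback.lift l (representableMap F (hW₁ w w.2).1) ?_, ?_⟩
      · rw [hl, representableMap_comp]
      · rw [pullback.lift_fst_assoc, hl]
    choose l hl using hl
    -- A nonzero map from `h_z` to the intersection stays nonzero in `h_x`, so it is a scalar
    -- multiple of the inclusion, which factors through some `h_w` with `w ∈ W`.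
    have hfg : IsFinitelyGenerated (pullback a b) := by
      refine (isFinitelyGenerated_iff _).2
        ⟨Set.range fun w : W => ⟨w.1, l w⟩, Set.finite_range _, fun B i _ hi => ?_⟩
      refine (epi_iff_representable_lift i).2 fun z g => ?_
      by_cases hg : g = 0
      · exact ⟨0, by rw [hg, zero_comp]⟩
      have hgk : g ≫ k ≠ 0 := fun h0 => hg (zero_of_comp_mono k h0)
      obtain ⟨hzx, c, hc, hgc⟩ := exists_smul_representableMap _ hgk
      have hzZ : ∃ y' ∈ Z, z ≤ y' := (haZ z hzx).1 ⟨c⁻¹ • (g ≫ pullback.fst a b), by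
        rw [Linear.smul_comp, Category.assoc, hgc, smul_smul, inv_mul_cancel₀ hc, one_smul]⟩
      have hgs : g ≫ pullback.snd a b ≠ 0 := fun h0 => hgk (by
        rw [hk, ← Category.assoc, h0, zero_comp])
      obtain ⟨hzy, -⟩ := exists_smul_representableMap _ hgs
      obtain ⟨w, hw, hzw⟩ := hW₂ z hzy hzZ
      obtain ⟨m, hm⟩ := hi _ ⟨⟨w, hw⟩, rfl⟩
      refine ⟨c • (representableMap F hzw ≫ m), ?_⟩
      rw [← cancel_mono k, Linear.smul_comp, Category.assoc, hm, Linear.smul_comp, Category.assoc,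
        hl, representableMap_comp, hgc]
    refine ⟨_, image.ι (biprod.desc a b), inferInstance,
      isFinitelyPresented_image_desc a b hA (isFinitelyPresented_representable y) hfg,
      fun z hz => ⟨?_, ?_⟩⟩
    · rintro ⟨l, hl⟩
      let m := Projective.factorThru l (factorThruImage (biprod.desc a b))
      have hm : m ≫ biprod.fst ≫ a + m ≫ biprod.snd ≫ b = representableMap F hz := by
        rw [← Preadditive.comp_add, ← biprod.desc_eq, ← image.fac (biprod.desc a b),
          Projective.factorThru_comp_assoc, hl]
      -- Either the `h_y` component vanishes and the map lands in `A`, or it is nonzero and forces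
      -- `z ≤ y`.
      by_cases h0 : m ≫ biprod.snd = 0
      · rw [← Category.assoc m biprod.snd, h0, zero_comp, add_zero, ← Category.assoc] at hm
        obtain ⟨y', hy', hzy'⟩ := (haZ z hz).1 ⟨_, hm⟩
        exact ⟨y', Finset.mem_insert_of_mem hy', hzy'⟩
      · exact ⟨y, Finset.mem_insert_self _ _, (exists_smul_representableMap _ h0).1⟩
    · rintro ⟨y', hy', hzy'⟩
      obtain rfl | hy' := Finset.mem_insert.1 hy'
      · exact ⟨representableMap F hzy' ≫ biprod.inr ≫ factorThruImage _, by
          simp only [Category.assoc, image.fac, biprod.inr_desc]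
          exact representableMap_comp _ _⟩
      · obtain ⟨l, hl⟩ := (haZ z hz).2 ⟨y', hy', hzy'⟩
        exact ⟨l ≫ biprod.inl ≫ factorThruImage _, by
          simp only [Category.assoc, image.fac, biprod.inl_desc, hl]⟩

/-- With `Z` the sources of the nonzero generators of `U`, the object `A` built from `Z` is the same
subobject as `U`: both projections from their intersection are isomorphisms. -/
lemma subobjectsCoherent_representable (hP : IsCoherentPoset P) (x : P) :
    SubobjectsCoherent (representable F x) := by
  classical
  intro U u _ hU
  obtain ⟨s, hs, hgen⟩ := (isFinitelyGenerated_iff U).1 hU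
  let Z : Finset P := (hs.toFinset.filter fun p => p.2 ≫ u ≠ 0).image Sigma.fst
  have hZ : ∀ y, y ∈ Z ↔ ∃ p ∈ s, p.2 ≫ u ≠ 0 ∧ p.1 = y := fun y => by
    simp [Z, -ne_eq, and_assoc]
  obtain ⟨A, a, _, hA, haZ⟩ := exists_isFinitelyPresented_subobject (F := F) hP x Z (by
    intro y hy
    obtain ⟨p, -, hp, rfl⟩ := (hZ y).1 hy
    exact (exists_smul_representableMap _ hp).1)
  have h₁ : Epi (pullback.fst u a) := hgen.epi _ fun p hp => by
    suffices h : ∃ l, l ≫ a = p.2 ≫ u by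
      obtain ⟨l, hl⟩ := h
      exact ⟨pullback.lift p.2 l hl.symm, pullback.lift_fst _ _ _⟩
    by_cases h0 : p.2 ≫ u = 0
    · exact ⟨0, by rw [h0, zero_comp]⟩
    obtain ⟨h, c, -, hc⟩ := exists_smul_representableMap _ h0
    obtain ⟨l, hl⟩ := (haZ p.1 h).2 ⟨p.1, (hZ _).2 ⟨p, hp, h0, rfl⟩, le_rfl⟩
    exact ⟨c • l, by rw [Linear.smul_comp, hl, hc]⟩
  have h₂ : Epi (pullback.snd u a) := (epi_iff_representable_lift _).2 fun z g => by
    suffices h : ∃ l, l ≫ u = g ≫ a by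
      obtain ⟨l, hl⟩ := h
      exact ⟨pullback.lift l g hl, pullback.lift_snd _ _ _⟩
    by_cases h0 : g ≫ a = 0
    · exact ⟨0, by rw [h0, zero_comp]⟩
    obtain ⟨h, c, hc, hgc⟩ := exists_smul_representableMap _ h0
    obtain ⟨y, hy, hzy⟩ := (haZ z h).1 ⟨c⁻¹ • g, by
      rw [Linear.smul_comp, hgc, smul_smul, inv_mul_cancel₀ hc, one_smul]⟩
    obtain ⟨p, hp, hpu, rfl⟩ := (hZ y).1 hy
    obtain ⟨h', c', hc', hpc'⟩ := exists_smul_representableMap _ hpu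
    refine ⟨(c * c'⁻¹) • (representableMap F hzy ≫ p.2), ?_⟩
    rw [Linear.smul_comp, Category.assoc, hpc', Linear.comp_smul, representableMap_comp, smul_smul,
      mul_assoc, inv_mul_cancel₀ hc', mul_one, hgc]
  have : IsIso (pullback.fst u a) := isIso_of_mono_of_epi _
  have : IsIso (pullback.snd u a) := isIso_of_mono_of_epi _
  exact hA.of_iso ((asIso (pullback.snd u a)).symm ≪≫ asIso (pullback.fst u a))

lemma isCoherentObject_representable (hP : IsCoherentPoset P) (x : P) :
    IsCoherentObject (representable F x) :=
  ⟨isFinitelyPresented_representable x,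
    fun U hU => subobjectsCoherent_representable hP x U.arrow hU⟩

/-! ### Pullbacks of finitely presented representations -/

lemma exists_finset_le_of_isFinitelyGenerated {Q : Rep P F} (hQ : IsFinitelyGenerated Q) :
    ∃ Z : Finset P, (∀ z ∈ Z, ∃ g : representable F z ⟶ Q, g ≠ 0) ∧
      ∀ (z : P) (g : representable F z ⟶ Q), g ≠ 0 → ∃ w ∈ Z, z ≤ w := by
  classical
  obtain ⟨s, hs, hgen⟩ := (isFinitelyGenerated_iff Q).1 hQ
  let Z : Finset P := (hs.toFinset.filter fun p => p.2 ≠ 0).image Sigma.fst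
  have hZ : ∀ y, y ∈ Z ↔ ∃ p ∈ s, p.2 ≠ 0 ∧ p.1 = y := fun y => by
    simp [Z, -ne_eq, and_assoc]
  refine ⟨Z, fun z hz => ?_, fun z g hg => ?_⟩
  · obtain ⟨p, -, hp, rfl⟩ := (hZ z).1 hz
    exact ⟨p.2, hp⟩
  -- Restricting `Q` to the ideal generated by `Z` and extending by zero gives a subrepresentation,
  -- as transition maps go downwards. It contains all generators, so `Q` vanishes off that ideal.
  let N : ∀ y : Pᵒᵖ, Submodule F (Q.obj y) := fun y => if ∃ w ∈ Z, y.unop ≤ w then ⊤ else ⊥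
  have hN : ∀ {y z} (f : y ⟶ z), ∀ a ∈ N y, (Q.map f).hom a ∈ N z := by
    intro y z f a ha
    by_cases hy : ∃ w ∈ Z, y.unop ≤ w
    · obtain ⟨w, hw, hyw⟩ := hy
      have : N z = ⊤ := if_pos ⟨w, hw, (leOfHom f.unop).trans hyw⟩
      rw [this]
      trivial
    · have : N y = ⊥ := if_neg hy
      rw [this, Submodule.mem_bot] at ha
      rw [ha, map_zero]
      exact zero_mem _
  have : Epi (subι Q N hN) := hgen.epi _ fun p hp => by
    by_cases h0 : p.2 = 0
    · exact ⟨0, by rw [h0, zero_comp]⟩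
    have hmem : (p.2.app (op p.1)).hom (unit F p.1) ∈ N (op p.1) := by
      have : N (op p.1) = ⊤ := if_pos ⟨p.1, (hZ _).2 ⟨p, hp, h0, rfl⟩, le_rfl⟩
      rw [this]
      trivial
    refine ⟨ofElement (X := sub Q N hN) ⟨_, hmem⟩, representable_hom_ext ?_⟩
    exact congrArg ((subι Q N hN).app (op p.1)).hom (ofElement_unit (X := sub Q N hN) ⟨_, hmem⟩)
  by_contra hz
  obtain ⟨l, hl⟩ := (epi_iff_representable_lift _).1 this z g
  refine hg (representable_hom_ext ?_)
  have hbot : N (op z) ≤ ⊥ := (if_neg hz).le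
  rw [← hl]
  exact hbot ((l.app (op z)).hom (unit F z)).2

/-- `Q` is not assumed to be a pullback in `Rep P F`; its universal property is tested only on
representables, which are finitely presented. -/
lemma isCoherentPoset_of_hasPullbacks [HasPullbacks (FPRep P F)] : IsCoherentPoset P := by
  intro x y y' hy hy'
  let H : P → FPRep P F := fun z => ⟨representable F z, isFinitelyPresented_representable z⟩
  let β : ∀ {w z : P}, w ≤ z → (H w ⟶ H z) := fun h => ObjectProperty.homMk (representableMap F h)
  let Q := pullback (β hy) (β hy')
  have hQ : ∀ z, (∃ g : representable F z ⟶ Q.obj, g ≠ 0) ↔ z ≤ y ∧ z ≤ y' := by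
    refine fun z => ⟨?_, ?_⟩
    · rintro ⟨g, hg⟩
      let g' : H z ⟶ Q := ObjectProperty.homMk g
      let o : H z ⟶ Q := ObjectProperty.homMk 0
      have hw : g ≫ (pullback.fst (β hy) (β hy')).hom ≫ representableMap F hy =
          g ≫ (pullback.snd (β hy) (β hy')).hom ≫ representableMap F hy' :=
        congrArg (fun φ => g ≫ φ.hom) (pullback.condition (f := β hy) (g := β hy'))
      have h₁ : g ≫ (pullback.fst (β hy) (β hy')).hom = 0 ↔
          g ≫ (pullback.snd (β hy) (β hy')).hom = 0 := by
        rw [← cancel_mono (representableMap F hy), zero_comp, Category.assoc, hw,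
          ← Category.assoc]
        exact ⟨fun h => zero_of_comp_mono _ h, fun h => by rw [h, zero_comp]⟩
      have h₂ : g ≫ (pullback.fst (β hy) (β hy')).hom ≠ 0 := fun h0 => by
        have : g' = o := pullback.hom_ext (ObjectProperty.hom_ext _ (h0.trans zero_comp.symm))
          (ObjectProperty.hom_ext _ ((h₁.1 h0).trans zero_comp.symm))
        exact hg (congrArg (fun φ => φ.hom) this)
      exact ⟨(exists_smul_representableMap _ h₂).1,
        (exists_smul_representableMap _ (h₂ ∘ h₁.2)).1⟩
    · rintro ⟨hz, hz'⟩
      let g : H z ⟶ Q := pullback.lift (β hz) (β hz')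
        (ObjectProperty.hom_ext _ ((representableMap_comp hz hy).trans
          (representableMap_comp hz' hy').symm))
      have hg : g.hom ≫ (pullback.fst (β hy) (β hy')).hom = representableMap F hz :=
        congrArg (fun φ : H z ⟶ H y => φ.hom) (pullback.lift_fst (f := β hy) (g := β hy') _ _ _)
      refine ⟨g.hom, fun h0 => representableMap_ne_zero (F := F) hz ?_⟩
      rw [← hg, h0, zero_comp]
  obtain ⟨Z, hZ₁, hZ₂⟩ := exists_finset_le_of_isFinitelyGenerated Q.property.1
  refine ⟨Z, fun z hz => (hQ z).1 (hZ₁ z hz), fun z hz hz' => ?_⟩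
  obtain ⟨g, hg⟩ := (hQ z).2 ⟨hz, hz'⟩
  exact hZ₂ z g hg

end

/-! ### Compact ideals -/

variable {P : Type u} [PartialOrder P]

/-- An ideal is the union of its principal ideals, and joins of ideals are unions, so each generator
lies in a single member of a cover. -/
lemma lowerSet_isCompactElement_iff {α : Type*} [Preorder α] (I : LowerSet α) :
    IsCompactElement I ↔ ∃ Z : Finset α, ∀ z, z ∈ I ↔ ∃ w ∈ Z, z ≤ w := by
  classical
  constructor
  · intro h
    obtain ⟨t, ht⟩ := CompleteLattice.IsCompactElement.exists_finset_of_le_iSup _ h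
      (fun z : I => LowerSet.Iic z.1) fun z hz =>
        LowerSet.mem_iSup_iff.2 ⟨⟨z, hz⟩, le_rfl⟩
    refine ⟨t.image Subtype.val, fun z => ⟨fun hz => ?_, ?_⟩⟩
    · obtain ⟨w, hw, hzw⟩ := LowerSet.mem_iSup₂_iff.1 (ht hz)
      exact ⟨w, Finset.mem_image_of_mem _ hw, hzw⟩
    · rintro ⟨w, hw, hzw⟩
      obtain ⟨w, -, rfl⟩ := Finset.mem_image.1 hw
      exact I.lower hzw w.2
  · rintro ⟨Z, hZ⟩
    rw [CompleteLattice.isCompactElement_iff_exists_le_sSup_of_le_sSup]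
    intro S hS
    have : ∀ w : Z, ∃ J ∈ S, w.1 ∈ J := fun w =>
      LowerSet.mem_sSup_iff.1 (hS ((hZ w).2 ⟨w, w.2, le_rfl⟩))
    choose J hJ hwJ using this
    refine ⟨Finset.univ.image J, by simpa [Set.range_subset_iff] using hJ, fun z hz => ?_⟩
    obtain ⟨w, hw, hzw⟩ := (hZ z).1 hz
    have hle : J ⟨w, hw⟩ ≤ (Finset.univ.image J).sup id :=
      Finset.le_sup (f := id) (Finset.mem_image_of_mem _ (Finset.mem_univ _))
    exact hle ((J ⟨w, hw⟩).lower hzw (hwJ ⟨w, hw⟩))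

lemma isCoherentPoset_iff_inf_compact :
    IsCoherentPoset P ↔ ∀ (x : P) (s : Finset (LowerSet (Set.Iic x))),
      (∀ I ∈ s, IsCompactElement I) → IsCompactElement (s.inf id) := by
  classical
  constructor
  · intro hP x s hs
    induction s using Finset.induction_on with
    | empty =>
      -- The empty meet is all of `↓x`, which is generated by `x`.
      refine (lowerSet_isCompactElement_iff _).2 ⟨{⟨x, le_rfl⟩}, fun z => ?_⟩
      exact ⟨fun _ => ⟨_, Finset.mem_singleton_self _, z.2⟩, fun _ => trivial⟩
    | insert I s _ ih =>
      rw [Finset.inf_insert, lowerSet_isCompactElement_iff]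
      obtain ⟨Z₁, hZ₁⟩ := (lowerSet_isCompactElement_iff _).1 (hs I (Finset.mem_insert_self _ _))
      obtain ⟨Z₂, hZ₂⟩ := (lowerSet_isCompactElement_iff _).1
        (ih fun J hJ => hs J (Finset.mem_insert_of_mem hJ))
      have : ∀ p : Set.Iic x × Set.Iic x, ∃ W : Finset (Set.Iic x), ∀ z,
          (∃ w ∈ W, z ≤ w) ↔ z ≤ p.1 ∧ z ≤ p.2 := by
        rintro ⟨y, y'⟩
        obtain ⟨W, hW₁, hW₂⟩ := hP x y y' y.2 y'.2
        refine ⟨W.subtype (· ∈ Set.Iic x), fun z => ⟨?_, ?_⟩⟩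
        · rintro ⟨w, hw, hzw⟩
          have := hW₁ w (Finset.mem_subtype.1 hw)
          exact ⟨le_trans hzw this.1, le_trans hzw this.2⟩
        · rintro ⟨h, h'⟩
          obtain ⟨w, hw, hzw⟩ := hW₂ z h h'
          exact ⟨⟨w, (hW₁ w hw).1.trans y.2⟩, Finset.mem_subtype.2 hw, hzw⟩
      choose W hW using this
      refine ⟨(Z₁ ×ˢ Z₂).biUnion W, fun z => ?_⟩
      rw [LowerSet.mem_inf_iff, id, hZ₁, hZ₂]
      constructor
      · rintro ⟨⟨y, hy, hzy⟩, y', hy', hzy'⟩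
        obtain ⟨w, hw, hzw⟩ := (hW (y, y') z).2 ⟨hzy, hzy'⟩
        exact ⟨w, Finset.mem_biUnion.2 ⟨_, Finset.mk_mem_product hy hy', hw⟩, hzw⟩
      · rintro ⟨w, hw, hzw⟩
        obtain ⟨p, hp, hw⟩ := Finset.mem_biUnion.1 hw
        have := (hW p z).1 ⟨w, hw, hzw⟩
        rw [Finset.mem_product] at hp
        exact ⟨⟨_, hp.1, this.1⟩, _, hp.2, this.2⟩
  · intro h x y y' hy hy'
    have hIic : ∀ z : Set.Iic x, IsCompactElement (LowerSet.Iic z) := fun z =>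
      (lowerSet_isCompactElement_iff _).2 ⟨{z}, fun w => by simp⟩
    have hinf := h x {LowerSet.Iic ⟨y, hy⟩, LowerSet.Iic ⟨y', hy'⟩} (by simp [hIic])
    obtain ⟨Z, hZ⟩ := (lowerSet_isCompactElement_iff _).1 hinf
    simp only [Finset.inf_insert, Finset.inf_singleton, id, LowerSet.mem_inf_iff,
      LowerSet.mem_Iic_iff] at hZ
    refine ⟨Z.image Subtype.val, fun z hz => ?_, fun z hz hz' => ?_⟩
    · obtain ⟨w, hw, rfl⟩ := Finset.mem_image.1 hz
      exact (hZ w).2 ⟨w, hw, le_rfl⟩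
    · obtain ⟨w, hw, hzw⟩ := (hZ ⟨z, hz.trans hy⟩).1 ⟨hz, hz'⟩
      exact ⟨w, Finset.mem_image_of_mem _ hw, hzw⟩

end PosetRep

theorem mainTheorem1 (P : Type u) [PartialOrder P] (F : Type v) [Field F] :
    List.TFAE [
      PosetRep.IsCoherentPoset P,
      ∀ (x : P) (s : Finset (LowerSet (Set.Iic x))),
        (∀ I ∈ s, IsCompactElement I) → IsCompactElement (s.inf id),
      ∀ x : P, PosetRep.IsCoherentObject (PosetRep.representable F x),
      Nonempty (Abelian (PosetRep.FPRep P F))] := by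
  tfae_have 1 ↔ 2 := PosetRep.isCoherentPoset_iff_inf_compact
  tfae_have 1 → 3 := PosetRep.isCoherentObject_representable
  tfae_have 3 → 4 := fun h => PosetRep.nonempty_abelian_finitelyPresented
    (PosetRep.subobjectsCoherent_of_isFinitelyPresented h)
  tfae_have 4 → 1 := fun ⟨_⟩ => PosetRep.isCoherentPoset_of_hasPullbacks (F := F)
  tfae_finish
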